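/- Let $\mathscr X$ be a complex Banach space and $\omega>0$. Let $\mathcal X=\mathcal P_\omega(\mathbb R,\mathscr X)$ be the Banach space of continuous $\omega$-periodic functions $x:\mathbb R\to\mathscr X$ with the norm $\|x\|=\sup_t\|x(t)\|$, and let $v\in\mathcal F=\mathcal P_\omega(\mathbb R,\operatorname{End}\mathscr X)$, i.e. $v$ is a norm-continuous $\omega$-periodic function with values in the bounded linear operators on $\mathscr X$, $\|v\|_{\mathcal F}=\sup_t\|v(t)\|$. Let $A=-i\frac{d}{dt}$ in $\mathcal X$, with domain $D(A)=\{x\in\mathcal X: x \text{ is differentiable and } x'\in\mathcal X\}$, and let $V$ be the operator of multiplication by $v$, $(Vx)(t)=v(t)x(t)$. Assume that $$\frac{5.4\sqrt3\,\omega}{\pi}\,\|v\|_{\mathcal F}<1 .$$ Then there is an operator $C\in\operatorname{End}\mathscr X$ such that $A-V$ is similar to $A-V_0$, where $(V_0x)(t)=Cx(t)$ and both operators have domain $D(A)$. That is, there is a bounded linear operator $U:\mathcal X\to\mathcal X$ with bounded inverse such that $UD(A)=D(A)$ and $(A-V)Ux=U(A-V_0)x$ for all $x\in D(A)$. Thus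 the non-autonomous periodic problem reduces to an autonomous one: for $x,f\in\mathcal X$, the function $x$ is a (differentiable) solution of $-ix'(t)-v(t)x(t)=f(t)$, $t\in\mathbb R$, if and only if $u=U^{-1}x$ is a solution of $-iu'(t)-Cu(t)=h(t)$, $t\in\mathbb R$, with $h=U^{-1}f$. -/

import Mathlib

open scoped BoundedContinuousFunction

/-- The space `P_ω(ℝ, E)` of continuous `ω`-periodic functions `ℝ → E` with the supremum norm
(inherited from the bounded continuous functions). A continuous periodic function is bounded and
uniformly continuous, so for `ω > 0` these are exactly the vectors of `C_b(ℝ, E)` that are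
continuous under translations and fixed by the translation by `ω`. -/
def periodicSpace (ω : ℝ) (E : Type*) [NormedAddCommGroup E] [NormedSpace ℂ E] :
    Submodule ℂ (ℝ →ᵇ E) where
  carrier := {x | ∀ t, x (t + ω) = x t}
  add_mem' {x y} hx hy t := by
    change x (t + ω) + y (t + ω) = x t + y t
    rw [hx t, hy t]
  zero_mem' _ := rfl
  smul_mem' c x hx t := by
    change c • x (t + ω) = c • x t
    rw [hx t]

/-- The unperturbed operator `A = -i d/dt` in `P_ω(ℝ, E)`: its domain consists of the
`x ∈ P_ω(ℝ, E)` that are differentiable everywhere with derivative in `P_ω(ℝ, E)`, and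
`(A x)(t) = -i x'(t)`. -/
noncomputable def diffOp (ω : ℝ) (E : Type*) [NormedAddCommGroup E] [NormedSpace ℂ E] :
    periodicSpace ω E →ₗ.[ℂ] periodicSpace ω E where
  domain :=
    { carrier := {x | ∃ y : periodicSpace ω E, ∀ t, HasDerivAt x.1 (y.1 t) t}
      add_mem' := by
        rintro a b ⟨y, hy⟩ ⟨z, hz⟩
        exact ⟨y + z, fun t => (hy t).add (hz t)⟩
      zero_mem' := ⟨0, fun t => hasDerivAt_const t (0 : E)⟩
      smul_mem' := by
        rintro c a ⟨y, hy⟩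
        exact ⟨c • y, fun t => (hy t).const_smul c⟩ }
  toFun :=
    { toFun := fun x => (-Complex.I) • x.2.choose
      map_add' := by
        intro a b
        rw [← smul_add]
        congr 1
        refine Subtype.ext (BoundedContinuousFunction.ext fun t => ?_)
        exact ((a + b).2.choose_spec t).unique ((a.2.choose_spec t).add (b.2.choose_spec t))
      map_smul' := by
        intro c a
        rw [RingHom.id_apply, smul_comm c]
        congr 1
        refine Subtype.ext (BoundedContinuousFunction.ext fun t => ?_)
        exact ((c • a).2.choose_spec t).unique ((a.2.choose_spec t).const_smul c) }

/-- The value of `-i d/dt` does not depend on any choice: `(A x)(t) = -i x'(t)`. -/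
theorem diffOp_apply {ω : ℝ} {E : Type*} [NormedAddCommGroup E] [NormedSpace ℂ E]
    (x : (diffOp ω E).domain) (t : ℝ) :
    (diffOp ω E x).1 t = (-Complex.I) • deriv x.1.1 t := by
  change (-Complex.I) • (x.2.choose.1 t) = _
  rw [(x.2.choose_spec t).deriv]

/-- The equivalent description of `A = -i d/dt` as the generator of the translations:
`x ∈ D(A)` and `A x = y` if and only if `x(t) = x(s) + i ∫_s^t y(τ) dτ` for all `s ≤ t`. -/
theorem diffOp_eq_iff_integral {ω : ℝ} {E : Type*} [NormedAddCommGroup E] [NormedSpace ℂ E]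
    [CompleteSpace E] (x y : periodicSpace ω E) :
    (∃ h : x ∈ (diffOp ω E).domain, diffOp ω E ⟨x, h⟩ = y) ↔
      ∀ s t : ℝ, s ≤ t → x.1 t = x.1 s + Complex.I • ∫ τ in s..t, y.1 τ := by
  have hI : Complex.I * -Complex.I = 1 := by simp
  have hI' : -Complex.I * Complex.I = 1 := by simp
  constructor
  · rintro ⟨h, rfl⟩ s t -
    have hz := h.choose_spec
    have e : ∀ τ, (diffOp ω E ⟨x, h⟩).1 τ = (-Complex.I) • h.choose.1 τ := fun τ => rfl
    simp only [e]
    rw [intervalIntegral.integral_smul, smul_smul, hI, one_smul,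
      intervalIntegral.integral_eq_sub_of_hasDerivAt (fun τ _ => hz τ)
        (h.choose.1.continuous.intervalIntegrable _ _)]
    abel
  · intro H
    have hd : ∀ t, HasDerivAt x.1 ((Complex.I • y).1 t) t := by
      intro t
      have hy : Continuous (y.1 : ℝ → E) := y.1.continuous
      have h1 : HasDerivAt (fun u => ∫ τ in (t - 1)..u, y.1 τ) (y.1 t) t :=
        intervalIntegral.integral_hasDerivAt_right (hy.intervalIntegrable _ _)
          (hy.stronglyMeasurableAtFilter _ _) hy.continuousAt
      have h2 := (h1.const_smul Complex.I).const_add (x.1 (t - 1))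
      refine h2.congr_of_eventuallyEq ?_
      filter_upwards [lt_mem_nhds (show t - 1 < t by linarith)] with u hu
      exact H (t - 1) u hu.le
    refine ⟨⟨Complex.I • y, hd⟩, ?_⟩
    refine Subtype.ext (BoundedContinuousFunction.ext fun t => ?_)
    rw [diffOp_apply]
    change (-Complex.I) • deriv x.1 t = y.1 t
    rw [(hd t).deriv]
    change (-Complex.I) • (Complex.I • y.1 t) = y.1 t
    rw [smul_smul, hI', one_smul]

/-- The operator `V ∈ End P_ω(ℝ, E)` of multiplication by `v ∈ P_ω(ℝ, End E)`:
`(V x)(t) = v(t) x(t)`. -/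
noncomputable def mulOp {ω : ℝ} {E : Type*} [NormedAddCommGroup E] [NormedSpace ℂ E]
    (v : periodicSpace ω (E →L[ℂ] E)) : periodicSpace ω E →L[ℂ] periodicSpace ω E :=
  LinearMap.mkContinuous
    { toFun := fun x =>
        ⟨BoundedContinuousFunction.ofNormedAddCommGroup (fun t => v.1 t (x.1 t))
            (v.1.continuous.clm_apply x.1.continuous) (‖v‖ * ‖x‖)
            (fun t => (v.1 t).le_of_opNorm_le_of_le (v.1.norm_coe_le_norm t)
              (x.1.norm_coe_le_norm t)),
          fun t => by
            change v.1 (t + ω) (x.1 (t + ω)) = v.1 t (x.1 t)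
            rw [v.2 t, x.2 t]⟩
      map_add' := fun x y =>
        Subtype.ext (BoundedContinuousFunction.ext fun t => (v.1 t).map_add (x.1 t) (y.1 t))
      map_smul' := fun c x =>
        Subtype.ext (BoundedContinuousFunction.ext fun t => (v.1 t).map_smul c (x.1 t)) }
    ‖v‖
    (fun x => BoundedContinuousFunction.norm_ofNormedAddCommGroup_le _
      (mul_nonneg (norm_nonneg v) (norm_nonneg x))
      (fun t => (v.1 t).le_of_opNorm_le_of_le (v.1.norm_coe_le_norm t) (x.1.norm_coe_le_norm t)))

theorem mulOp_apply {ω : ℝ} {E : Type*} [NormedAddCommGroup E] [NormedSpace ℂ E]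
    (v : periodicSpace ω (E →L[ℂ] E)) (x : periodicSpace ω E) (t : ℝ) :
    (mulOp v x).1 t = v.1 t (x.1 t) := rfl

/-- The constant function with value `c`, as an element of `P_ω(ℝ, E)`. -/
def constPeriodic (ω : ℝ) {E : Type*} [NormedAddCommGroup E] [NormedSpace ℂ E] (c : E) :
    periodicSpace ω E :=
  ⟨BoundedContinuousFunction.const ℝ c, fun _ => rfl⟩

/-- The operator `A - B` with domain `D(A)`, for an unbounded operator `A` and a bounded operator
`B`. -/
def subBounded {X : Type*} [NormedAddCommGroup X] [NormedSpace ℂ X]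
    (A : X →ₗ.[ℂ] X) (B : X →L[ℂ] X) : X →ₗ.[ℂ] X where
  domain := A.domain
  toFun := A.toFun - (B : X →ₗ[ℂ] X).comp A.domain.subtype

/-- `U` is a transformation operator of `A₁` into `A₂`: `U` is a continuously invertible bounded
operator with `U D(A₂) = D(A₁)` and `A₁ U x = U A₂ x` for `x ∈ D(A₂)`. The operators `A₁` and `A₂`
are similar if such a `U` exists. -/
structure Intertwines {X : Type*} [NormedAddCommGroup X] [NormedSpace ℂ X]
    (U : X ≃L[ℂ] X) (A₁ A₂ : X →ₗ.[ℂ] X) : Prop where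
  image_domain : ⇑U '' (A₂.domain : Set X) = A₁.domain
  apply_eq : ∀ (x : A₂.domain) (y : A₁.domain), (y : X) = U x → A₁ y = U (A₂ x)

/-! The similarity is multiplication by a periodic operator function `W` close to the identity. If
`W' = i (v W - W C)` with a constant `C`, the product rule turns `u' = i (C u + h)` into the
equation `x' = i (v x + f)` for `x = W u`, `f = W h`. When every `W t` is invertible this can be
reversed, and both the equality of domains and the intertwining relation follow.

To find `W`, write `W = 1 + Y` with `Y` of mean zero. A periodic solution needs `v W - W C` to have
mean zero; since `W` has mean 1, this forces `C` to be the mean of `v W`. Let `S` be convolution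
with the sawtooth kernel: it inverts `d/dt` on mean-zero periodic functions, takes values of mean
zero, and has norm at most `ω / 3`. The equation becomes the fixed-point problem `Y = i S (v W - W ·
mean (v W))`, quadratic in `Y`. For `ω ‖v‖ ≤ 2/5` the right side is a contraction of the ball of
radius 1/2 (`exists_periodic_normalForm`). The assumed bound on `‖v‖` is stronger than this, and
radius 1/2 < 1 makes `W` invertible by the Neumann series. -/

/-! ### The sawtooth kernel: antiderivative, norm bound, mean. -/

/-- For continuous `ω`-periodic `f`, the sawtooth convolution `∫₀^ω (s/ω - 1/2) f(t+s) ds` is an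
antiderivative of `f` minus its mean. -/
theorem hasDerivAt_sawtooth_integral {F : Type*} [NormedAddCommGroup F] [NormedSpace ℝ F]
    [CompleteSpace F] {ω : ℝ} (hω : 0 < ω) {f : ℝ → F} (hf : Continuous f)
    (hp : Function.Periodic f ω) (t : ℝ) :
    HasDerivAt (fun t => ∫ s in (0 : ℝ)..ω, (s / ω - 1 / 2) • f (t + s))
      (f t - ω⁻¹ • ∫ s in (0 : ℝ)..ω, f s) t := by
  set g : ℝ → F := fun s => (s / ω - 1 / 2) • f s with hg
  have hgc : Continuous g := by fun_prop
  -- Since `s / ω - 1/2 = ((t + s) / ω - 1/2) - t / ω`, the variable `t` can be moved from the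
  -- integrand into the limits of integration, where the fundamental theorem of calculus applies.
  have key : (fun t => ∫ s in (0 : ℝ)..ω, (s / ω - 1 / 2) • f (t + s)) =
      fun t => ((∫ s in (0 : ℝ)..(t + ω), g s) - ∫ s in (0 : ℝ)..t, g s) -
        (t / ω) • ∫ s in (0 : ℝ)..ω, f s := by
    funext t
    have h1 : (∫ s in (0 : ℝ)..ω, (s / ω - 1 / 2) • f (t + s)) =
        ∫ s in (0 : ℝ)..ω, (fun u => g u - (t / ω) • f u) (t + s) := by
      congr 1
      funext s
      simp only [hg, ← sub_smul]
      congr 1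
      ring
    have h2 := hp.intervalIntegral_add_eq t 0
    rw [zero_add] at h2
    rw [h1, intervalIntegral.integral_comp_add_left (fun u => g u - (t / ω) • f u) t, add_zero,
      intervalIntegral.integral_sub (hgc.intervalIntegrable _ _)
        ((by fun_prop : Continuous fun u => (t / ω) • f u).intervalIntegrable _ _),
      intervalIntegral.integral_smul, h2,
      intervalIntegral.integral_interval_sub_left (hgc.intervalIntegrable _ _)
        (hgc.intervalIntegrable _ _)]
  have hG : ∀ x, HasDerivAt (fun x => ∫ s in (0 : ℝ)..x, g s) (g x) x := fun x =>
    intervalIntegral.integral_hasDerivAt_right (hgc.intervalIntegrable _ _)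
      (hgc.stronglyMeasurableAtFilter _ _) hgc.continuousAt
  have hd := (((hG (t + ω)).comp_add_const t ω).sub (hG t)).sub
    (((hasDerivAt_id t).div_const ω).smul_const (∫ s in (0 : ℝ)..ω, f s))
  rw [key]
  refine hd.congr_deriv ?_
  simp only [hg, hp t, ← sub_smul, one_div]
  congr 1
  rw [show (t + ω) / ω - 2⁻¹ - (t / ω - 2⁻¹) = 1 by field_simp; ring, one_smul]

/-- The majorant `|a| ≤ a ^ 2 + 1/4` replaces the absolute value of the kernel by a polynomial. This
gives `ω / 12 + ω / 4 = ω / 3` instead of the exact L¹ norm `ω / 4`, which is good enough here. -/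
theorem norm_sawtooth_integral_le {F : Type*} [NormedAddCommGroup F] [NormedSpace ℝ F]
    {ω : ℝ} (hω : 0 < ω) {f : ℝ → F} {M : ℝ} (hM : ∀ t, ‖f t‖ ≤ M) (t : ℝ) :
    ‖∫ s in (0 : ℝ)..ω, (s / ω - 1 / 2) • f (t + s)‖ ≤ ω / 3 * M := by
  have hM0 : 0 ≤ M := (norm_nonneg _).trans (hM 0)
  have h : ∀ s, ‖(s / ω - 1 / 2) • f (t + s)‖ ≤ ((s / ω - 1 / 2) ^ 2 + 1 / 4) * M := by
    intro s
    rw [norm_smul, Real.norm_eq_abs]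
    refine mul_le_mul ?_ (hM _) (norm_nonneg _) (by positivity)
    rw [abs_le]
    constructor <;> nlinarith [sq_nonneg (s / ω - 1 / 2 - 1 / 2), sq_nonneg (s / ω - 1 / 2 + 1 / 2)]
  refine (intervalIntegral.norm_integral_le_of_norm_le hω.le
    (Filter.Eventually.of_forall fun s _ => h s)
    (Continuous.intervalIntegrable (by fun_prop) _ _)).trans_eq ?_
  rw [intervalIntegral.integral_mul_const]
  congr 1
  have hd : ∀ s ∈ Set.uIcc 0 ω, HasDerivAt
      (fun s : ℝ => ω * (s / ω - 1 / 2) ^ 3 / 3 + s / 4) ((s / ω - 1 / 2) ^ 2 + 1 / 4) s := by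
    intro s _
    have h1 := ((hasDerivAt_id s).div_const ω).sub_const (1 / 2)
    refine ((((h1.pow 3).const_mul ω).div_const 3).add ((hasDerivAt_id s).div_const 4)).congr_deriv ?_
    change ω * ((3 : ℕ) * (s / ω - 1 / 2) ^ 2 * (1 / ω)) / 3 + 1 / 4 = _
    push_cast
    field_simp
  rw [intervalIntegral.integral_eq_sub_of_hasDerivAt hd
    (Continuous.intervalIntegrable (by fun_prop) _ _), div_self hω.ne']
  ring

/-- By Fubini and periodicity the double integral factors into the integral of the kernel, which
vanishes, and that of `f`. -/
theorem integral_sawtooth_integral_eq_zero {F : Type*} [NormedAddCommGroup F] [NormedSpace ℝ F]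
    [CompleteSpace F] {ω : ℝ} (hω : 0 < ω) {f : ℝ → F} (hf : Continuous f) (hp : Function.Periodic f ω) :
    ∫ t in (0 : ℝ)..ω, ∫ s in (0 : ℝ)..ω, (s / ω - 1 / 2) • f (t + s) = 0 := by
  rw [MeasureTheory.intervalIntegral_intervalIntegral_swap]
  · have h : ∀ s, ∫ t in (0 : ℝ)..ω, (s / ω - 1 / 2) • f (t + s) =
        (s / ω - 1 / 2) • ∫ t in (0 : ℝ)..ω, f t := by
      intro s
      have h2 := hp.intervalIntegral_add_eq s 0
      rw [zero_add] at h2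
      rw [intervalIntegral.integral_smul, intervalIntegral.integral_comp_add_right, zero_add,
        add_comm, h2]
    simp only [h]
    rw [intervalIntegral.integral_smul_const, intervalIntegral.integral_sub
      (Continuous.intervalIntegrable (by fun_prop) _ _)
      (Continuous.intervalIntegrable (by fun_prop) _ _), intervalIntegral.integral_div, integral_id,
      intervalIntegral.integral_const]
    convert zero_smul ℝ _ using 2
    simp only [smul_eq_mul]
    field_simp
    ring
  · have hc : Continuous (Function.uncurry fun t s => (s / ω - 1 / 2) • f (t + s)) := by
      unfold Function.uncurry; fun_prop
    exact (hc.continuousOn.integrableOn_compact (isCompact_uIcc.prod isCompact_uIcc)).mono_set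
      (Set.prod_mono Set.uIoc_subset_uIcc Set.uIoc_subset_uIcc)

/-! ### Completeness, mean value and sawtooth operator on the periodic space. -/

instance completeSpace_periodicSpace (ω : ℝ) (E : Type*) [NormedAddCommGroup E] [NormedSpace ℂ E]
    [CompleteSpace E] : CompleteSpace (periodicSpace ω E) := by
  have h : IsClosed (periodicSpace ω E : Set (ℝ →ᵇ E)) := by
    change IsClosed {x : ℝ →ᵇ E | ∀ t, x (t + ω) = x t}
    simp only [Set.ofPred_forall]
    exact isClosed_iInter fun t => isClosed_eq
      (continuous_eval_const (t + ω)) (continuous_eval_const t)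
  exact h.completeSpace_coe

/-- The mean value over a period. -/
noncomputable def periodicMean (ω : ℝ) (E : Type*) [NormedAddCommGroup E] [NormedSpace ℂ E] :
    periodicSpace ω E →ₗ[ℂ] E where
  toFun f := ω⁻¹ • ∫ s in (0 : ℝ)..ω, f.1 s
  map_add' f g := by
    rw [← smul_add, ← intervalIntegral.integral_add (f.1.continuous.intervalIntegrable _ _)
      (g.1.continuous.intervalIntegrable _ _)]
    rfl
  map_smul' c f := by
    rw [RingHom.id_apply, smul_comm c, ← intervalIntegral.integral_smul c]
    rfl

theorem norm_periodicMean_le {ω : ℝ} (hω : 0 < ω) {E : Type*} [NormedAddCommGroup E]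
    [NormedSpace ℂ E] (f : periodicSpace ω E) : ‖periodicMean ω E f‖ ≤ ‖f‖ := by
  change ‖ω⁻¹ • ∫ s in (0 : ℝ)..ω, f.1 s‖ ≤ _
  have h := intervalIntegral.norm_integral_le_of_norm_le_const (a := 0) (b := ω)
    (fun s _ => f.1.norm_coe_le_norm s)
  rw [sub_zero, abs_of_pos hω] at h
  rw [norm_smul, norm_inv, Real.norm_of_nonneg hω.le, inv_mul_le_iff₀ hω, mul_comm]
  exact h

theorem periodicMean_const {ω : ℝ} (hω : 0 < ω) {E : Type*} [NormedAddCommGroup E]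
    [NormedSpace ℂ E] [CompleteSpace E] (c : E) : periodicMean ω E (constPeriodic ω c) = c := by
  change ω⁻¹ • ∫ s in (0 : ℝ)..ω, c = c
  rw [intervalIntegral.integral_const, sub_zero, smul_smul, inv_mul_cancel₀ hω.ne', one_smul]

/-- The mean-zero periodic antiderivative of a periodic function, up to its mean. -/
noncomputable def sawtoothConv {ω : ℝ} (hω : 0 < ω) (E : Type*) [NormedAddCommGroup E]
    [NormedSpace ℂ E] : periodicSpace ω E →ₗ[ℂ] periodicSpace ω E where
  toFun f :=
    ⟨BoundedContinuousFunction.ofNormedAddCommGroup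
        (fun t => ∫ s in (0 : ℝ)..ω, (s / ω - 1 / 2) • f.1 (t + s))
        (intervalIntegral.continuous_parametric_intervalIntegral_of_continuous' (by
          have := f.1.continuous
          unfold Function.uncurry
          fun_prop) _ _)
        (ω / 3 * ‖f‖) (norm_sawtooth_integral_le hω f.1.norm_coe_le_norm),
      fun t => by
        change (∫ s in (0 : ℝ)..ω, (s / ω - 1 / 2) • f.1 (t + ω + s)) =
          ∫ s in (0 : ℝ)..ω, (s / ω - 1 / 2) • f.1 (t + s)
        simp only [add_right_comm t ω, f.2 _]⟩
  map_add' f g := by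
    refine Subtype.ext (BoundedContinuousFunction.ext fun t => ?_)
    have hf := f.1.continuous
    have hg := g.1.continuous
    change (∫ s in (0 : ℝ)..ω, (s / ω - 1 / 2) • (f.1 (t + s) + g.1 (t + s))) =
      (∫ s in (0 : ℝ)..ω, (s / ω - 1 / 2) • f.1 (t + s)) +
        ∫ s in (0 : ℝ)..ω, (s / ω - 1 / 2) • g.1 (t + s)
    simp only [smul_add]
    exact intervalIntegral.integral_add (Continuous.intervalIntegrable (by fun_prop) _ _)
      (Continuous.intervalIntegrable (by fun_prop) _ _)
  map_smul' c f := by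
    refine Subtype.ext (BoundedContinuousFunction.ext fun t => ?_)
    change (∫ s in (0 : ℝ)..ω, (s / ω - 1 / 2) • (c • f.1 (t + s))) =
      c • ∫ s in (0 : ℝ)..ω, (s / ω - 1 / 2) • f.1 (t + s)
    simp only [smul_comm _ c]
    exact intervalIntegral.integral_smul _ _

section sawtoothConv

variable {ω : ℝ} (hω : 0 < ω) {E : Type*} [NormedAddCommGroup E] [NormedSpace ℂ E]

theorem norm_sawtoothConv_le (f : periodicSpace ω E) :
    ‖sawtoothConv hω E f‖ ≤ ω / 3 * ‖f‖ :=
  BoundedContinuousFunction.norm_ofNormedAddCommGroup_le _ (by positivity)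
    (norm_sawtooth_integral_le hω f.1.norm_coe_le_norm)

theorem hasDerivAt_sawtoothConv [CompleteSpace E] (f : periodicSpace ω E) (t : ℝ) :
    HasDerivAt (sawtoothConv hω E f).1 (f.1 t - periodicMean ω E f) t :=
  hasDerivAt_sawtooth_integral hω f.1.continuous f.2 t

theorem periodicMean_sawtoothConv [CompleteSpace E] (f : periodicSpace ω E) :
    periodicMean ω E (sawtoothConv hω E f) = 0 := by
  change ω⁻¹ • ∫ t in (0 : ℝ)..ω, ∫ s in (0 : ℝ)..ω, (s / ω - 1 / 2) • f.1 (t + s) = 0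
  rw [integral_sawtooth_integral_eq_zero hω f.1.continuous f.2, smul_zero]

end sawtoothConv

/-! ### The normal form equation, solved by contraction. -/

section normalForm

variable {ω : ℝ} {R : Type*} [NormedRing R] [NormedAlgebra ℂ R]

/-- The pointwise product of periodic functions with values in a normed algebra. -/
noncomputable def periodicMul (f g : periodicSpace ω R) : periodicSpace ω R :=
  ⟨f.1 * g.1, fun t => by
    change f.1 (t + ω) * g.1 (t + ω) = f.1 t * g.1 t
    rw [f.2, g.2]⟩

theorem norm_periodicMul_le (f g : periodicSpace ω R) : ‖periodicMul f g‖ ≤ ‖f‖ * ‖g‖ :=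
  norm_mul_le f.1 g.1

theorem norm_constPeriodic_le (ω : ℝ) {E : Type*} [NormedAddCommGroup E] [NormedSpace ℂ E]
    (c : E) : ‖constPeriodic ω c‖ ≤ ‖c‖ :=
  BoundedContinuousFunction.norm_const_le c

theorem periodicMean_periodicMul_const [CompleteSpace R] (f : periodicSpace ω R) (c : R) :
    periodicMean ω R (periodicMul f (constPeriodic ω c)) = periodicMean ω R f * c := by
  change ω⁻¹ • ∫ s in (0 : ℝ)..ω, f.1 s * c = (ω⁻¹ • ∫ s in (0 : ℝ)..ω, f.1 s) * c
  rw [smul_mul_assoc]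
  congr 1
  exact ((ContinuousLinearMap.mul ℝ R).flip c).intervalIntegral_comp_comm
    (f.1.continuous.intervalIntegrable 0 ω)

/-- `v W - W c`, with `c` the mean of `v W`. -/
noncomputable def normalFormRhs (v W : periodicSpace ω R) : periodicSpace ω R :=
  periodicMul v W - periodicMul W (constPeriodic ω (periodicMean ω R (periodicMul v W)))

theorem norm_normalFormRhs_le (hω : 0 < ω) (v W : periodicSpace ω R) :
    ‖normalFormRhs v W‖ ≤ ‖v‖ * ‖W‖ * (1 + ‖W‖) := by
  have h1 := norm_periodicMul_le v W
  have h2 := (norm_constPeriodic_le ω _).trans ((norm_periodicMean_le hω _).trans h1)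
  have h3 := (norm_periodicMul_le W _).trans (mul_le_mul_of_nonneg_left h2 (norm_nonneg W))
  refine (norm_sub_le _ _).trans ((add_le_add h1 h3).trans_eq (by ring))

/-- The expression is a linear term minus a quadratic one, so the difference telescopes into three
terms, each linear in `W - W'`; the order of the factors is kept because `R` need not commute. -/
theorem norm_normalFormRhs_sub_le (hω : 0 < ω) (v W W' : periodicSpace ω R) :
    ‖normalFormRhs v W - normalFormRhs v W'‖ ≤ ‖v‖ * (1 + ‖W‖ + ‖W'‖) * ‖W - W'‖ := by
  have e : normalFormRhs v W - normalFormRhs v W' =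
      periodicMul v (W - W') -
        periodicMul (W - W') (constPeriodic ω (periodicMean ω R (periodicMul v W))) -
        periodicMul W' (constPeriodic ω (periodicMean ω R (periodicMul v (W - W')))) := by
    have e1 : periodicMul v (W - W') = periodicMul v W - periodicMul v W' :=
      Subtype.ext (mul_sub _ _ _)
    refine Subtype.ext (BoundedContinuousFunction.ext fun t => ?_)
    rw [e1, map_sub]
    change v.1 t * W.1 t - W.1 t * periodicMean ω R (periodicMul v W) -
        (v.1 t * W'.1 t - W'.1 t * periodicMean ω R (periodicMul v W')) =
      (v.1 t * W.1 t - v.1 t * W'.1 t) -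
        (W.1 t - W'.1 t) * periodicMean ω R (periodicMul v W) -
        W'.1 t * (periodicMean ω R (periodicMul v W) - periodicMean ω R (periodicMul v W'))
    noncomm_ring
  have hm : ∀ f : periodicSpace ω R,
      ‖constPeriodic ω (periodicMean ω R (periodicMul v f))‖ ≤ ‖v‖ * ‖f‖ := fun f =>
    (norm_constPeriodic_le ω _).trans ((norm_periodicMean_le hω _).trans (norm_periodicMul_le v f))
  have h1 := norm_periodicMul_le v (W - W')
  have h2 := (norm_periodicMul_le (W - W') _).trans
    (mul_le_mul_of_nonneg_left (hm W) (norm_nonneg (W - W')))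
  have h3 := (norm_periodicMul_le W' _).trans
    (mul_le_mul_of_nonneg_left (hm (W - W')) (norm_nonneg W'))
  rw [e]
  refine (norm_sub_le _ _).trans ((add_le_add ((norm_sub_le _ _).trans (add_le_add h1 h2)) h3).trans_eq
    (by ring))

/-- If `ω ‖v‖ ≤ 2/5`, there are a constant `c` and a periodic `W` within `1/2` of the identity with
`W' = i (v W - W c)`. -/
theorem exists_periodic_normalForm [CompleteSpace R] (hω : 0 < ω) (h1 : ‖(1 : R)‖ ≤ 1)
    (v : periodicSpace ω R) (hv : ω * ‖v‖ ≤ 2 / 5) :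
    ∃ (c : R) (W : periodicSpace ω R), ‖W - constPeriodic ω 1‖ ≤ 1 / 2 ∧
      ∀ t, HasDerivAt W.1 (Complex.I • (v.1 t * W.1 t - W.1 t * c)) t := by
  set e : periodicSpace ω R := constPeriodic ω 1
  have he : ‖e‖ ≤ 1 := (norm_constPeriodic_le ω _).trans h1
  let T : periodicSpace ω R → periodicSpace ω R := fun Y =>
    Complex.I • sawtoothConv hω R (normalFormRhs v (e + Y))
  let s : Set (periodicSpace ω R) := Metric.closedBall 0 (1 / 2)
  have hs : ∀ Y ∈ s, ‖e + Y‖ ≤ 3 / 2 := fun Y hY => by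
    have := norm_add_le e Y
    have := mem_closedBall_zero_iff.1 hY
    linarith
  have hv0 := norm_nonneg v
  have hT : Set.MapsTo T s s := by
    intro Y hY
    refine mem_closedBall_zero_iff.2 ?_
    have hW := hs Y hY
    -- With the factor `ω / 3` the bound is `(5/4) ω ‖v‖ ≤ 1/2`, exactly the radius; this is where
    -- 2/5 comes from.
    have h2 : ‖v‖ * ‖e + Y‖ * (1 + ‖e + Y‖) ≤ ‖v‖ * (3 / 2) * (1 + 3 / 2) := by gcongr
    have h3 := (norm_normalFormRhs_le hω v (e + Y)).trans h2
    have h4 := (norm_sawtoothConv_le hω _).trans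
      (mul_le_mul_of_nonneg_left h3 (by positivity : 0 ≤ ω / 3))
    rw [norm_smul, Complex.norm_I, one_mul]
    linarith
  -- The Lipschitz constant is `(ω / 3) · 4 ‖v‖ ≤ 8/15`.
  have hL : ∀ Y ∈ s, ∀ Z ∈ s, dist (T Y) (T Z) ≤ (8 / 15 : NNReal) * dist Y Z := by
    intro Y hY Z hZ
    have hW := hs Y hY
    have hW' := hs Z hZ
    have h2 := norm_normalFormRhs_sub_le hω v (e + Y) (e + Z)
    rw [add_sub_add_left_eq_sub] at h2
    have h3 : ‖v‖ * (1 + ‖e + Y‖ + ‖e + Z‖) * ‖Y - Z‖ ≤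
        ‖v‖ * (1 + 3 / 2 + 3 / 2) * ‖Y - Z‖ := by gcongr
    have h4 := (norm_sawtoothConv_le hω _).trans
      (mul_le_mul_of_nonneg_left (h2.trans h3) (by positivity : 0 ≤ ω / 3))
    have h6 : T Y - T Z = Complex.I •
        sawtoothConv hω R (normalFormRhs v (e + Y) - normalFormRhs v (e + Z)) := by
      rw [map_sub, smul_sub]
    rw [dist_eq_norm, dist_eq_norm, h6, norm_smul, Complex.norm_I, one_mul]
    refine h4.trans ?_
    have h5 := mul_le_mul_of_nonneg_right hv (norm_nonneg (Y - Z))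
    push_cast
    linarith
  have hc : ContractingWith (8 / 15) (hT.restrict T s s) := by
    refine ⟨?_, LipschitzWith.of_dist_le_mul fun Y Z => hL Y Y.2 Z Z.2⟩
    rw [← NNReal.coe_lt_coe]
    push_cast
    norm_num
  obtain ⟨Y, hYs, hY, -⟩ := hc.exists_fixedPoint' (x := 0)
    Metric.isClosed_closedBall.isComplete hT (Metric.mem_closedBall_self (by norm_num))
    (edist_ne_top _ _)
  replace hY : T Y = Y := hY
  have hm : periodicMean ω R Y = 0 := by
    rw [← hY]
    simp only [T, map_smul, periodicMean_sawtoothConv, smul_zero]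
  -- As `Y` has mean zero, `e + Y` has mean 1, so the mean of `W c` is `c`, the mean of `v W`. Hence
  -- `S` differentiates back to the right-hand side with no correction term.
  have hrhs : periodicMean ω R (normalFormRhs v (e + Y)) = 0 := by
    rw [normalFormRhs, map_sub, periodicMean_periodicMul_const, map_add, hm, add_zero,
      periodicMean_const hω, one_mul, sub_self]
  refine ⟨periodicMean ω R (periodicMul v (e + Y)), e + Y, ?_, fun t => ?_⟩
  · rw [add_sub_cancel_left]
    exact mem_closedBall_zero_iff.1 hYs
  · have h2 := (hasDerivAt_sawtoothConv hω (normalFormRhs v (e + Y)) t).const_smul Complex.I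
    rw [hrhs, sub_zero] at h2
    have h3 : HasDerivAt (T Y).1 (Complex.I • (normalFormRhs v (e + Y)).1 t) t := h2
    rw [hY] at h3
    exact h3.const_add 1

end normalForm

/-! ### Multiplication by `W` as a transformation operator. -/

section transformation

variable {ω : ℝ} {E : Type*} [NormedAddCommGroup E] [NormedSpace ℂ E]

theorem norm_mulOp_le (v : periodicSpace ω (E →L[ℂ] E)) : ‖mulOp v‖ ≤ ‖v‖ :=
  LinearMap.mkContinuous_norm_le _ (norm_nonneg v) _

theorem isUnit_of_norm_sub_one_lt {R : Type*} [NormedRing R] [CompleteSpace R] {a : R}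
    (h : ‖a - 1‖ < 1) : IsUnit a := by
  have := isUnit_one_sub_of_norm_lt_one (x := 1 - a) (by rwa [norm_sub_rev])
  rwa [sub_sub_cancel] at this

theorem isUnit_mulOp [CompleteSpace E] {W : periodicSpace ω (E →L[ℂ] E)}
    (hW : ‖W - constPeriodic ω 1‖ < 1) : IsUnit (mulOp W) := by
  refine isUnit_of_norm_sub_one_lt (R := periodicSpace ω E →L[ℂ] periodicSpace ω E)
    (lt_of_le_of_lt ?_ hW)
  have e : mulOp W - 1 = mulOp (W - constPeriodic ω 1) := by
    ext x t
    rfl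
  rw [e]
  exact norm_mulOp_le _

theorem isUnit_apply_of_norm_sub_one_lt [CompleteSpace E] {W : periodicSpace ω (E →L[ℂ] E)}
    (hW : ‖W - constPeriodic ω 1‖ < 1) (t : ℝ) : IsUnit (W.1 t) :=
  isUnit_of_norm_sub_one_lt (((W - constPeriodic ω 1).1.norm_coe_le_norm t).trans_lt hW)

/-- One direction is the product rule. For the other, `x` is recovered by applying the pointwise
inverse of `W`, which is differentiable because inversion is differentiable at units. -/
theorem hasDerivAt_clm_apply_iff_of_isUnit [CompleteSpace E] {W : ℝ → E →L[ℂ] E}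
    {W' : E →L[ℂ] E} {x : ℝ → E} {x' : E} {t : ℝ} (hU : ∀ s, IsUnit (W s))
    (hW : HasDerivAt W W' t) :
    HasDerivAt (fun s => W s (x s)) (W' (x t) + W t x') t ↔ HasDerivAt x x' t := by
  have apply_deriv : ∀ {W : ℝ → E →L[ℂ] E} {W' : E →L[ℂ] E} {x : ℝ → E} {x' : E},
      HasDerivAt W W' t → HasDerivAt x x' t →
      HasDerivAt (fun s => W s (x s)) (W' (x t) + W t x') t := by
    intro W W' x x' hW hx
    have hR : HasDerivAt (fun s => (W s).restrictScalars ℝ) (W'.restrictScalars ℝ) t :=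
      -- The time variable is real, so the complex-linear operators are viewed as real-linear ones
      -- before the product rule is used.
      (ContinuousLinearMap.restrictScalarsL ℂ E E ℝ ℝ).hasFDerivAt.comp_hasDerivAt t hW
    exact hR.clm_apply hx
  refine ⟨fun h => ?_, apply_deriv hW⟩
  obtain ⟨u, hu⟩ := hU t
  have hinv : DifferentiableAt ℝ (fun s => Ring.inverse (W s)) t := by
    have := (hasFDerivAt_ringInverse (𝕜 := ℝ) u).differentiableAt
    rw [hu] at this
    exact this.comp t hW.differentiableAt
  have hx := apply_deriv hinv.hasDerivAt h
  have hl : ∀ s y, Ring.inverse (W s) (W s y) = y := fun s y =>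
    congrArg (fun T : E →L[ℂ] E => T y) (Ring.inverse_mul_cancel _ (hU s))
  simp only [hl] at hx
  -- Now `x` is differentiable, with a derivative in unwieldy form. The product rule and uniqueness
  -- of derivatives show that `W t` sends it and `x'` to the same vector; injectivity of `W t`
  -- identifies them.
  have e := (apply_deriv hW hx).unique h
  have e' := congrArg (fun z => Ring.inverse (W t) z) (add_left_cancel e)
  rw [hl, hl] at e'
  rwa [e'] at hx

/-- A periodic solution of `W' = i (v W - W C)` that is close to the identity transforms
`x' = i (v x + f)` into `u' = i (C u + h)`. -/
theorem hasDerivAt_mulOp_iff [CompleteSpace E] {v W : periodicSpace ω (E →L[ℂ] E)}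
    {C : E →L[ℂ] E} (hU : ∀ t, IsUnit (W.1 t))
    (hW : ∀ t, HasDerivAt W.1 (Complex.I • (v.1 t * W.1 t - W.1 t * C)) t)
    (u h : periodicSpace ω E) (t : ℝ) :
    HasDerivAt (mulOp W u).1 (Complex.I • (v.1 t ((mulOp W u).1 t) + (mulOp W h).1 t)) t ↔
      HasDerivAt u.1 (Complex.I • (C (u.1 t) + h.1 t)) t := by
  have e : Complex.I • (v.1 t ((mulOp W u).1 t) + (mulOp W h).1 t) =
      (Complex.I • (v.1 t * W.1 t - W.1 t * C)) (u.1 t) +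
        W.1 t (Complex.I • (C (u.1 t) + h.1 t)) := by
    change Complex.I • (v.1 t (W.1 t (u.1 t)) + W.1 t (h.1 t)) =
      Complex.I • (v.1 t (W.1 t (u.1 t)) - W.1 t (C (u.1 t))) + _
    rw [map_smul, map_add, ← smul_add]
    congr 1
    abel
  rw [e]
  exact hasDerivAt_clm_apply_iff_of_isUnit hU (hW t)

/-- `x ∈ D(A)` and `(A - V) x = f` if and only if `x' = i (v x + f)`. -/
theorem subBounded_diffOp_mulOp_eq_iff (v : periodicSpace ω (E →L[ℂ] E))
    (x f : periodicSpace ω E) :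
    (∃ h : x ∈ (subBounded (diffOp ω E) (mulOp v)).domain,
      subBounded (diffOp ω E) (mulOp v) ⟨x, h⟩ = f) ↔
      ∀ t, HasDerivAt x.1 (Complex.I • (v.1 t (x.1 t) + f.1 t)) t := by
  constructor
  · rintro ⟨h, rfl⟩ t
    obtain ⟨y, hy⟩ := h
    have e : (subBounded (diffOp ω E) (mulOp v) ⟨x, ⟨y, hy⟩⟩).1 t =
        (-Complex.I) • deriv x.1 t - v.1 t (x.1 t) := by
      rw [← diffOp_apply ⟨x, ⟨y, hy⟩⟩ t]
      rfl
    rw [e, add_sub_cancel, smul_smul, mul_neg, Complex.I_mul_I, neg_neg, one_smul, (hy t).deriv]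
    exact hy t
  · intro H
    have h : x ∈ (diffOp ω E).domain := ⟨Complex.I • (mulOp v x + f), H⟩
    refine ⟨h, Subtype.ext (BoundedContinuousFunction.ext fun t => ?_)⟩
    change (diffOp ω E ⟨x, h⟩).1 t - v.1 t (x.1 t) = f.1 t
    rw [diffOp_apply, (H t).deriv, smul_smul, neg_mul, Complex.I_mul_I, neg_neg, one_smul,
      add_sub_cancel_left]

end transformation

/-! ### The similarity theorem. -/

theorem mainTheorem8 {E : Type*} [NormedAddCommGroup E] [NormedSpace ℂ E] [CompleteSpace E]
    (ω : ℝ) (hω : 0 < ω) (v : periodicSpace ω (E →L[ℂ] E))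
    (hv : 5.4 * Real.sqrt 3 * ω / Real.pi * ‖v‖ < 1) :
    ∃ (C : E →L[ℂ] E) (U : periodicSpace ω E ≃L[ℂ] periodicSpace ω E),
      Intertwines U
        (subBounded (diffOp ω E) (mulOp v))
        (subBounded (diffOp ω E) (mulOp (constPeriodic ω C))) ∧
      ∀ x f : periodicSpace ω E,
        (∀ t, HasDerivAt x.1 (Complex.I • (v.1 t (x.1 t) + f.1 t)) t) ↔
          (∀ t, HasDerivAt (U.symm x).1
            (Complex.I • (C ((U.symm x).1 t) + (U.symm f).1 t)) t) := by
  -- Numerically, `π / (5.4 √3) < 3.15 / (5.4 · 1.7) < 2/5`.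
  have hsmall : ω * ‖v‖ ≤ 2 / 5 := by
    have hpi := Real.pi_pos
    have h3 : (1.7 : ℝ) ≤ Real.sqrt 3 := Real.le_sqrt_of_sq_le (by norm_num)
    have h4 : 5.4 * Real.sqrt 3 * (ω * ‖v‖) < Real.pi := by
      rw [div_mul_eq_mul_div, div_lt_one hpi] at hv
      linarith
    have h5 := mul_le_mul_of_nonneg_right h3 (by positivity : 0 ≤ ω * ‖v‖)
    linarith [Real.pi_lt_d2]
  obtain ⟨C, W, hW1, hW⟩ :=
    -- Only `‖1‖ ≤ 1` is available, since `E` may be the zero space.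
    exists_periodic_normalForm hω ContinuousLinearMap.norm_id_le v hsmall
  have hlt : ‖W - constPeriodic ω 1‖ < 1 := hW1.trans_lt (by norm_num)
  have hunit := isUnit_apply_of_norm_sub_one_lt hlt
  obtain ⟨u, hu⟩ := isUnit_mulOp hlt
  let U : periodicSpace ω E ≃L[ℂ] periodicSpace ω E := ContinuousLinearEquiv.unitsEquiv ℂ _ u
  have hUW : ∀ x, U x = mulOp W x := fun x => by rw [← hu]; rfl
  have hsol : ∀ y h : periodicSpace ω E,
      (∀ t, HasDerivAt (U y).1 (Complex.I • (v.1 t ((U y).1 t) + (U h).1 t)) t) ↔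
        ∀ t, HasDerivAt y.1 (Complex.I • (C (y.1 t) + h.1 t)) t := fun y h => by
    rw [hUW, hUW]
    exact forall_congr' (hasDerivAt_mulOp_iff hunit hW y h)
  -- The equivalence of solutions, restated for the unbounded operators. Existence of the membership
  -- proof carries the domain equality, and the equation carries the intertwining.
  have hop : ∀ y h : periodicSpace ω E,
      (∃ hy : U y ∈ (subBounded (diffOp ω E) (mulOp v)).domain,
        subBounded (diffOp ω E) (mulOp v) ⟨U y, hy⟩ = U h) ↔
      ∃ hy : y ∈ (subBounded (diffOp ω E) (mulOp (constPeriodic ω C))).domain,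
        subBounded (diffOp ω E) (mulOp (constPeriodic ω C)) ⟨y, hy⟩ = h := fun y h => by
    rw [subBounded_diffOp_mulOp_eq_iff, subBounded_diffOp_mulOp_eq_iff]
    exact hsol y h
  refine ⟨C, U, ⟨?_, ?_⟩, fun x f => ?_⟩
  · ext y
    constructor
    · rintro ⟨x, hx, rfl⟩
      exact ((hop x _).2 ⟨hx, rfl⟩).1
    · intro hy
      obtain ⟨x, rfl⟩ := U.surjective y
      obtain ⟨h, hh⟩ := U.surjective (subBounded (diffOp ω E) (mulOp v) ⟨U x, hy⟩)
      exact ⟨x, ((hop x h).1 ⟨hy, hh.symm⟩).1, rfl⟩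
  · rintro x ⟨y, hy⟩ rfl
    exact ((hop x _).2 ⟨x.2, rfl⟩).2
  · have := hsol (U.symm x) (U.symm f)
    rwa [U.apply_symm_apply, U.apply_symm_apply] at this
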